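/- All graphs are finite and simple. For a graph $H$ and $n \ge 1$, let $\mathrm{ex}(n,H)$ be the maximum number of edges of a graph on $n$ vertices that contains no (not necessarily induced) subgraph isomorphic to $H$. For integers $r_1, r_2 \ge 3$ and $q \ge 1$, the dumbbell graph $D_b(r_1,r_2;q)$ consists of two vertex-disjoint cycles of lengths $r_1$ and $r_2$ together with a path of length $q$ that joins a vertex of the first cycle to a vertex of the second and meets the cycles only in these two endpoints; $D_b(r_1,r_2;0)$ consists of two cycles of lengths $r_1$ and $r_2$ having exactly one vertex in common. Theorem 5. Let $r_1 \ge 3$, $r_2 \ge 4$ and $q \ge 0$ be integers such that $r_1 + r_2$ is odd, and let $k = 3r_1 + 3r_2 + 2q - 12$. Then for every integer $n \ge k^2 + k$, $$\mathrm{ex}\bigl(n, D_b(r_1,r_2;q)\bigr) = \left\lfloor \frac{n^2}{4} \right\rfloor .$$ -/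

import Mathlib

/-- The dumbbell graph `D_b(r₁, r₂; q)` for `r₁, r₂ ≥ 3` and `q ≥ 0`: two cycles of lengths `r₁` and
`r₂` joined by a path of length `q` that meets each cycle only in an endpoint; for `q = 0` the two
cycles share exactly one vertex. There are `r₁ + r₂ + q - 1` vertices, numbered from `0`, and
consecutive numbers are adjacent.
* `0, 1, …, r₁ - 1` form the first cycle, closed by the edge between `0` and `r₁ - 1`;
* `r₁ - 1, r₁, …, r₁ - 1 + q` form the joining path, of length `q`;
* `r₁ - 1 + q, …, r₁ + r₂ + q - 2` form the second cycle, closed by the edge between these two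
  ends. -/
def dumbbellGraph (r₁ r₂ q : ℕ) : SimpleGraph (Fin (r₁ + r₂ + q - 1)) :=
  SimpleGraph.fromRel fun u v =>
    u.val + 1 = v.val ∨
    (u.val = 0 ∧ v.val = r₁ - 1) ∨
    (u.val = r₁ - 1 + q ∧ v.val = r₁ + r₂ + q - 2)

/-!
The lower bound is witnessed by the balanced complete bipartite graph (`turanGraph n 2`): since
`r₁ + r₂` is odd, one cycle of the dumbbell is odd, so the dumbbell is not bipartite.

For the upper bound, let `a = 2t + 3` be the length of the odd cycle and `b = 2r + 4` that of the
even one, and let `G` have `n` vertices and more than `n² / 4` edges.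

*Passing to large minimum degree* (`SimpleGraph.exists_dense_isContained`). Put `c = ⌊7k / 5⌋`
and, as long as the current graph, on `m` vertices, has a vertex of degree less than `max ⌊m / 2⌋
c`, delete that vertex. While `m > 2c`, each deletion increases the surplus of the number of edges
over `⌊m² / 4⌋`; after that, each deletion loses at most `c - 1` edges. As `n ≥ c (c + 1) / 2`, a
graph on only `c` vertices reached in this way would have more than `c.choose 2` edges. So the
process stops at a graph with a number `m ≤ 2h + 1` of vertices and minimum degree at least `h :=
max ⌊m / 2⌋ c`, which still has more than `m² / 4` edges and hence a triangle.

*The odd cycle* (`SimpleGraph.exists_odd_cycle_list`). Starting from the triangle, an odd cycle `F`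
is lengthened by two by replacing an edge `uv` with a path `u p r v`, where `p` and `r` lie outside
`F`. If this is impossible, then there is no edge between `A = N(u) \ F` and `B = N(v) \ F`. Since
all degrees are at least about half the order, the structure is then rigid. If `A` and `B` are
disjoint, then `A` is nearly a clique and contains the cycle. Otherwise all neighbours of vertices
of `A ∩ B` lie outside `A ∪ B`, the bipartite graph between these two sets is dense, and an
alternating path in it closes up through the edge `uv`.

*The rest of the dumbbell* (`SimpleGraph.dumbbellGraph_isContained_of_le_degree`). A greedy path
of length `q` leads from the odd cycle to a vertex `w`. The even cycle through `w` comes from a path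
of length `b - 2` alternating between the unused neighbours of `w` and all unused vertices.

Alternating paths are found by `SimpleGraph.exists_alternating_path`: a dense bipartite graph has a
subgraph of large minimum degree, in which such a path is built greedily.

Paths are represented by duplicate-free lists of vertices whose consecutive entries are adjacent,
and cycles by such lists with adjacent first and last entries; paths grow at the head of the list.
-/

open Finset

/-! ### Greedy and alternating paths -/

theorem List.exists_mem_finset_notMem {V : Type*} [DecidableEq V] {s : Finset V} {l : List V}
    (h : l.length < #s) : ∃ x ∈ s, x ∉ l := by
  obtain ⟨x, hx, hxl⟩ := Finset.exists_mem_notMem_of_card_lt_card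
    (l.toFinset_card_le.trans_lt h)
  exact ⟨x, hx, by simpa using hxl⟩

namespace SimpleGraph
variable {V : Type*} [Fintype V] [DecidableEq V] {G : SimpleGraph V} [DecidableRel G.Adj]

/-- A path whose first vertex lies in a set `s` inducing minimum degree at least `d` can be
continued greedily inside `s` as long as it has fewer than `d` edges. -/
theorem exists_isChain_append {s : Finset V} {d : ℕ}
    (hs : ∀ v ∈ s, d ≤ #(G.neighborFinset v ∩ s)) {j : ℕ} {w : V} {l : List V} (hw : w ∈ s)
    (hchain : (w :: l).IsChain G.Adj) (hnd : (w :: l).Nodup) (hj : l.length + j ≤ d) :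
    ∃ t : List V, t.length = j ∧ (t ++ w :: l).IsChain G.Adj ∧ (t ++ w :: l).Nodup ∧
      ∀ x ∈ t, x ∈ s := by
  induction j generalizing w l with
  | zero => exact ⟨[], rfl, hchain, hnd, by simp⟩
  | succ j ih =>
    have hd := hs w hw
    obtain ⟨x, hx, hxl⟩ := List.exists_mem_finset_notMem (l := l) (s := G.neighborFinset w ∩ s)
      (by omega)
    rw [mem_inter, mem_neighborFinset] at hx
    obtain ⟨t, ht, hc, hn, hts⟩ := ih (w := x) (l := w :: l) hx.2
      (List.isChain_cons_cons.mpr ⟨hx.1.symm, hchain⟩)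
      (List.nodup_cons.mpr ⟨by simp [hx.1.ne', hxl], hnd⟩) (by simp; omega)
    refine ⟨t ++ [x], by simp [ht], by simpa using hc, by simpa using hn, ?_⟩
    intro y hy
    rcases List.mem_append.mp hy with h | h
    · exact hts y h
    · rw [List.mem_singleton.mp h]; exact hx.2

/-- If there are more than `α |A| + β |X|` adjacent pairs in `A × X`, then repeatedly discarding the
vertices of `A` with at most `α` remaining neighbours in `X`, and the vertices of `X` with at most
`β` remaining neighbours in `A`, cannot exhaust these pairs. The sets `A` and `X` may overlap. -/
theorem exists_subset_lt_card_inter_neighborFinset {α β : ℕ} {A X : Finset V}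
    (h : α * #A + β * #X < ∑ a ∈ A, #(G.neighborFinset a ∩ X)) :
    ∃ A' ⊆ A, ∃ X' ⊆ X, A'.Nonempty ∧ (∀ a ∈ A', α < #(G.neighborFinset a ∩ X')) ∧
      ∀ x ∈ X', β < #(G.neighborFinset x ∩ A') := by
  induction hN : #A + #X using Nat.strong_induction_on generalizing A X with
  | _ N ih =>
    subst hN
    by_cases hA : ∃ a ∈ A, #(G.neighborFinset a ∩ X) ≤ α
    · obtain ⟨a, ha, hle⟩ := hA
      have hc := card_erase_add_one ha
      have hsum := add_sum_erase A (fun a => #(G.neighborFinset a ∩ X)) ha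
      obtain ⟨A', hA', X', hX', H⟩ := ih (#(A.erase a) + #X) (by omega) (A := A.erase a) (X := X)
        (by rw [← hc, mul_add] at h; omega) rfl
      exact ⟨A', hA'.trans (erase_subset _ _), X', hX', H⟩
    by_cases hX : ∃ x ∈ X, #(G.neighborFinset x ∩ A) ≤ β
    · obtain ⟨x, hx, hle⟩ := hX
      have hc := card_erase_add_one hx
      have swap : ∀ X : Finset V, ∑ a ∈ A, #(G.neighborFinset a ∩ X) =
          ∑ x ∈ X, #(G.neighborFinset x ∩ A) := by
        intro X
        have := sum_card_bipartiteAbove_eq_sum_card_bipartiteBelow G.Adj (s := A) (t := X)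
        convert this using 3
        · ext; simp [bipartiteAbove, and_comm]
        · ext; simp [bipartiteBelow, and_comm, G.adj_comm]
      have hsum := add_sum_erase X (fun x => #(G.neighborFinset x ∩ A)) hx
      obtain ⟨A', hA', X', hX', H⟩ := ih (#A + #(X.erase x)) (by omega) (A := A) (X := X.erase x)
        (by rw [← hc, mul_add, swap] at h; rw [swap]; omega) rfl
      exact ⟨A', hA', X', hX'.trans (erase_subset _ _), H⟩
    push Not at hA hX
    refine ⟨A, subset_rfl, X, subset_rfl, ?_, hA, hX⟩
    rw [nonempty_iff_ne_empty]
    rintro rfl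
    simp at h

/-- If there are many adjacent pairs in `A × X`, there is a path of length `2 * t` which starts and
ends in `A` and alternates between `A` and `X`. As `A` and `X` may overlap, the whole path built so
far has to be avoided at each step, on both sides. -/
theorem exists_alternating_path {t : ℕ} {A X : Finset V}
    (h : (2 * t - 2) * #A + (2 * t - 1) * #X < ∑ a ∈ A, #(G.neighborFinset a ∩ X)) :
    ∃ (e : List V) (z y : V), e.length = 2 * t + 1 ∧ e.IsChain G.Adj ∧ e.Nodup ∧
      e.head? = some z ∧ z ∈ A ∧ e.getLast? = some y ∧ y ∈ A ∧ ∀ x ∈ e, x ∈ A ∪ X := by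
  obtain ⟨A', hA', X', hX', ⟨a, ha⟩, hdA, hdX⟩ := exists_subset_lt_card_inter_neighborFinset h
  have key : ∀ i ≤ t, ∃ (l : List V) (z y : V), l.length = 2 * i ∧ (z :: l).IsChain G.Adj ∧
      (z :: l).Nodup ∧ z ∈ A' ∧ (z :: l).getLast? = some y ∧ y ∈ A' ∧ ∀ x ∈ z :: l, x ∈ A ∪ X := by
    intro i
    induction i with
    | zero => exact fun _ => ⟨[], a, a, by simp [ha, hA' ha]⟩
    | succ i ih =>
      intro hi
      obtain ⟨l, z, y, hl, hc, hn, hz, hy, hyA, hall⟩ := ih (by omega)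
      have h1 := hdA z hz
      obtain ⟨u, hu, hul⟩ := List.exists_mem_finset_notMem (l := l)
        (s := G.neighborFinset z ∩ X') (by omega)
      rw [mem_inter, mem_neighborFinset] at hu
      have h2 := hdX u hu.2
      obtain ⟨v, hv, hvl⟩ := List.exists_mem_finset_notMem (l := z :: l)
        (s := G.neighborFinset u ∩ A') (by simp only [List.length_cons]; omega)
      rw [mem_inter, mem_neighborFinset] at hv
      refine ⟨u :: z :: l, v, y, by simp [hl]; ring, ?_, ?_, hv.2, by simpa using hy, hyA, ?_⟩
      · exact List.isChain_cons_cons.mpr ⟨hv.1.symm, List.isChain_cons_cons.mpr ⟨hu.1.symm, hc⟩⟩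
      · have : u ∉ z :: l := by simp [hu.1.ne', hul]
        exact List.nodup_cons.mpr ⟨by rw [List.mem_cons]; exact not_or.mpr ⟨hv.1.ne', hvl⟩,
          List.nodup_cons.mpr ⟨this, hn⟩⟩
      · intro x hx
        rcases List.mem_cons.mp hx with rfl | hx
        · exact mem_union_left _ (hA' hv.2)
        rcases List.mem_cons.mp hx with rfl | hx
        · exact mem_union_right _ (hX' hu.2)
        · exact hall x hx
  obtain ⟨l, z, y, hl, hc, hn, hz, hy, hyA, hall⟩ := key t le_rfl
  exact ⟨z :: l, z, y, by simp [hl], hc, hn, rfl, hA' hz, hy, hA' hyA, hall⟩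

/-! ### Odd cycles -/

/-- A set that induces a nearly complete graph, each vertex missing at most `d ≤ j` vertices of
the set (itself included), contains a cycle of length `j + 2`: a greedy path on `j + 1` vertices
is closed by a common neighbour of its ends. -/
theorem exists_cycle_list_of_card_le_add {s : Finset V} {j d : ℕ} (hj : 3 * j < #s)
    (hne : 1 ≤ j) (hd : d ≤ j)
    (hs : ∀ v ∈ s, #s ≤ #(G.neighborFinset v ∩ s) + d) :
    ∃ (l : List V) (x y : V), l.length = j + 2 ∧ l.IsChain G.Adj ∧ l.Nodup ∧
      l.head? = some x ∧ l.getLast? = some y ∧ G.Adj x y := by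
  obtain ⟨y, hy⟩ : s.Nonempty := card_pos.mp (by omega)
  obtain ⟨t, ht, hc, hn, hts⟩ := exists_isChain_append (G := G) (s := s) (d := #s - d)
    (fun v hv => by have := hs v hv; omega) (j := j) (w := y) (l := []) hy (by simp) (by simp)
    (by simp; omega)
  obtain _ | ⟨z, t⟩ := t
  · simp at ht; omega
  have hz : z ∈ s := hts z (by simp)
  have h1 := card_union_add_card_inter (G.neighborFinset z ∩ s) (G.neighborFinset y ∩ s)
  have h2 := card_le_card (union_subset (inter_subset_right (s₁ := G.neighborFinset z) (s₂ := s))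
    (inter_subset_right (s₁ := G.neighborFinset y) (s₂ := s)))
  have h3 := hs z hz
  have h4 := hs y hy
  simp only [List.length_cons] at ht
  obtain ⟨c, hcm, hcl⟩ := List.exists_mem_finset_notMem (l := t ++ [y])
    (s := (G.neighborFinset z ∩ s) ∩ (G.neighborFinset y ∩ s))
    (by rw [List.length_append, List.length_singleton]; omega)
  simp only [mem_inter, mem_neighborFinset] at hcm
  refine ⟨c :: z :: (t ++ [y]), c, y, by simp; omega, ?_, ?_, rfl, ?_, hcm.2.1.symm⟩
  · exact List.isChain_cons_cons.mpr ⟨hcm.1.1.symm, by simpa using hc⟩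
  · refine List.nodup_cons.mpr ⟨?_, by simpa using hn⟩
    rw [List.mem_cons]
    exact not_or.mpr ⟨hcm.1.1.ne', hcl⟩
  · rw [← List.cons_append, ← List.cons_append, List.getLast?_append]; simp

/-- The edge count that makes `exists_alternating_path` applicable between `A ∩ B`, of size `x`, and
the complement of `A ∪ B`, of size about `y`, in `exists_odd_cycle_list_of_inter_nonempty`. -/
theorem edge_count_bound {t g x y : ℕ} (hx : 4 * t + 15 + g ≤ x)
    (hy : y ≤ 10 * t + 23 + g) : 2 * t * x + (2 * t + 1) * y < x * (8 * t + 18 + g) := by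
  have h1 := Nat.mul_le_mul_left (2 * t + 1) hy
  have h2 := Nat.mul_le_mul_left (6 * t + 18 + g) hx
  have h3 : (6 * t + 18 + g) * (4 * t + 15 + g) = (2 * t + 1) * (10 * t + 23 + g) +
      (4 * t ^ 2 + 106 * t + 247 + 8 * (t * g) + 32 * g + g ^ 2) := by ring
  have h4 : x * (8 * t + 18 + g) = 2 * t * x + (6 * t + 18 + g) * x := by ring
  omega

/-- The bipartite-like case of lengthening an odd cycle: if there are no edges between large sets
`A ⊆ N(u)` and `B ⊆ N(v)`, where `uv` is an edge, and `A` meets `B`, then the edges at `A ∩ B` all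
go to the complement of `A ∪ B`. A path alternating between these two sets, with its ends in `A ∩
B`, closes up through `u` and `v`. -/
theorem exists_odd_cycle_list_of_inter_nonempty {h t : ℕ} (hcard : Fintype.card V ≤ 2 * h + 1)
    (hdeg : ∀ v, h ≤ G.degree v) {u v : V} (huv : G.Adj u v) {A B : Finset V}
    (hA : A ⊆ G.neighborFinset u) (hB : B ⊆ G.neighborFinset v) (hvA : v ∉ A)
    (hcA : h ≤ #A + (2 * t + 2)) (hcB : h ≤ #B + (2 * t + 2)) (ht : 8 * t + 20 ≤ h)
    (hno : ∀ x ∈ A, ∀ y ∈ B, ¬ G.Adj x y) (hne : (A ∩ B).Nonempty) :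
    ∃ (l : List V) (x y : V), l.length = 2 * t + 5 ∧ l.IsChain G.Adj ∧ l.Nodup ∧
      l.head? = some x ∧ l.getLast? = some y ∧ G.Adj x y := by
  have huA : u ∉ A := fun hu => by simpa using hA hu
  have hvB : v ∉ B := fun hv => by simpa using hB hv
  have hI : ∀ p ∈ A ∩ B, G.neighborFinset p ⊆ (A ∪ B)ᶜ := by
    intro p hp x hx
    rw [mem_inter] at hp
    rw [mem_neighborFinset] at hx
    rw [mem_compl, mem_union, not_or]
    exact ⟨fun h => hno x h p hp.2 hx.symm, fun h => hno p hp.1 x h hx⟩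
  have hI' : ∀ p ∈ A ∩ B, h ≤ #(G.neighborFinset p ∩ ((A ∪ B)ᶜ \ {u, v})) + 2 := by
    intro p hp
    have h1 := hdeg p
    rw [← card_neighborFinset_eq_degree, ← inter_eq_left.mpr (hI p hp)] at h1
    have h2 : #(G.neighborFinset p ∩ (A ∪ B)ᶜ) - #({u, v} : Finset V) ≤ _ :=
      le_card_sdiff {u, v} _
    have h3 := card_le_two (a := u) (b := v)
    rw [inter_sdiff_assoc] at h2
    omega
  obtain ⟨p, hp⟩ := hne
  have h1 := card_le_card (hI p hp)
  have h2 := hdeg p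
  rw [card_neighborFinset_eq_degree, card_compl] at h1
  have h3 := card_union_add_card_inter A B
  have h4 := card_le_univ (A ∪ B)
  have h5 := card_le_card (sdiff_subset (s := (A ∪ B)ᶜ) (t := {u, v}))
  rw [card_compl] at h5
  have h6 := card_le_card (subset_union_left (s₁ := A) (s₂ := B))
  obtain ⟨e, z, y, he, hc, hn, hz, hzm, hy, hym, hall⟩ :=
    exists_alternating_path (G := G) (t := t + 1) (A := A ∩ B) (X := (A ∪ B)ᶜ \ {u, v}) (by
      have hsum := card_nsmul_le_sum (A ∩ B)
        (fun a => #(G.neighborFinset a ∩ ((A ∪ B)ᶜ \ {u, v}))) (h - 2)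
        (fun p hp => by have := hI' p hp; omega)
      refine lt_of_lt_of_le ?_ hsum
      obtain ⟨g, rfl⟩ := Nat.exists_eq_add_of_le ht
      have e1 : 2 * (t + 1) - 2 = 2 * t := by omega
      have e2 : 2 * (t + 1) - 1 = 2 * t + 1 := by omega
      have e3 : 8 * t + 20 + g - 2 = 8 * t + 18 + g := by omega
      rw [e1, e2, e3, smul_eq_mul]
      have b1 : 4 * t + 15 + g ≤ #(A ∩ B) := by omega
      have b2 : #((A ∪ B)ᶜ \ {u, v}) ≤ 10 * t + 23 + g := by omega
      exact edge_count_bound b1 b2)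
  have huI : u ∉ e := fun hu => by
    have := hall u hu
    simp [huA] at this
  have hvI : v ∉ e := fun hv => by
    have := hall v hv
    simp [hvA] at this
  rw [mem_inter] at hzm hym
  refine ⟨u :: (e ++ [v]), u, v, by simp [he]; ring, ?_, ?_, rfl, ?_, huv⟩
  · rw [List.isChain_cons]
    refine ⟨?_, ?_⟩
    · rw [List.head?_append, hz]
      simpa using hA hzm.1
    · rw [List.isChain_append]
      refine ⟨hc, by simp, ?_⟩
      rw [hy]
      simpa using (G.mem_neighborFinset v y).mp (hB hym.2) |>.symm
  · rw [List.nodup_cons, List.nodup_append]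
    refine ⟨by simp [huI, huv.ne], hn, by simp, ?_⟩
    intro a ha b hb hab
    rw [List.mem_singleton] at hb
    exact hvI (hb ▸ hab ▸ ha)
  · rw [← List.cons_append, List.getLast?_append]; simp

/-- A graph on at most `2 * h + 1` vertices with minimum degree at least `h` that contains a
triangle contains a cycle of each odd length `2 * t + 3` with `8 * t + 12 ≤ h`. -/
theorem exists_odd_cycle_list {h : ℕ} (hcard : Fintype.card V ≤ 2 * h + 1)
    (hdeg : ∀ v, h ≤ G.degree v) (htri : ¬ G.CliqueFree 3) {t : ℕ} (ht : 8 * t + 12 ≤ h) :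
    ∃ (l : List V) (x y : V), l.length = 2 * t + 3 ∧ l.IsChain G.Adj ∧ l.Nodup ∧
      l.head? = some x ∧ l.getLast? = some y ∧ G.Adj x y := by
  induction t with
  | zero =>
    simp only [CliqueFree, not_forall, not_not] at htri
    obtain ⟨s, hs⟩ := htri
    obtain ⟨a, b, c, hab, hac, hbc, -⟩ := is3Clique_iff.mp hs
    exact ⟨[a, b, c], a, c, rfl, by simp [hab, hbc], by simp [hab.ne, hac.ne, hbc.ne], rfl, rfl,
      hac⟩
  | succ t ih =>
    obtain ⟨l, x, y, hl, hc, hn, hx, hy, hxy⟩ := ih (by omega)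
    match l, hl, hc, hn, hx, hy with
    | [], hl, _, _, _, _ => simp at hl
    | [_], hl, _, _, _, _ => simp at hl
    | u :: v :: l, hl, hc, hn, hx, hy =>
    obtain ⟨huv, hvl⟩ := List.isChain_cons_cons.mp hc
    have hcF : #(u :: v :: l).toFinset = 2 * t + 3 := by
      rw [List.toFinset_card_of_nodup hn, hl]
    have hcard_sdiff : ∀ w ∈ u :: v :: l,
        h ≤ #(G.neighborFinset w \ (u :: v :: l).toFinset) + (2 * t + 2) := by
      intro w hw
      have h1 := le_card_sdiff ((u :: v :: l).toFinset.erase w) (G.neighborFinset w)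
      rw [card_erase_of_mem (by simpa using hw), hcF, card_neighborFinset_eq_degree] at h1
      have h2 : G.neighborFinset w \ (u :: v :: l).toFinset.erase w =
          G.neighborFinset w \ (u :: v :: l).toFinset := by
        ext z
        simp only [mem_sdiff, mem_erase, mem_neighborFinset]
        constructor
        · rintro ⟨h1, h2⟩; exact ⟨h1, fun h => h2 ⟨h1.ne', h⟩⟩
        · rintro ⟨h1, h2⟩; exact ⟨h1, fun h => h2 h.2⟩
      rw [h2] at h1
      have := hdeg w
      omega
    have hcA := hcard_sdiff u (by simp)
    have hcB := hcard_sdiff v (by simp)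
    set A := G.neighborFinset u \ (u :: v :: l).toFinset with hAdef
    set B := G.neighborFinset v \ (u :: v :: l).toFinset with hBdef
    -- either the edge `uv` can be replaced by a path `u p r v`, or no edge joins `A` and `B`
    by_cases hno : ∀ p ∈ A, ∀ r ∈ B, ¬ G.Adj p r
    · by_cases hne : (A ∩ B).Nonempty
      · exact exists_odd_cycle_list_of_inter_nonempty hcard hdeg huv sdiff_subset sdiff_subset
          (by simp) hcA hcB (by omega) hno hne
      -- every `p ∈ A` has all its neighbours outside `B`, so `A` is nearly a clique
      · rw [not_nonempty_iff_eq_empty, ← disjoint_iff_inter_eq_empty] at hne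
        refine exists_cycle_list_of_card_le_add (s := A) (j := 2 * t + 3) (d := 2 * t + 3)
          (by omega) (by omega) le_rfl ?_
        intro p hp
        have h1 := hdeg p
        rw [← card_neighborFinset_eq_degree, ← card_inter_add_card_sdiff _ A] at h1
        have h2 : G.neighborFinset p \ A ⊆ (A ∪ B)ᶜ := by
          intro r hr
          rw [mem_sdiff, mem_neighborFinset] at hr
          rw [mem_compl, mem_union, not_or]
          exact ⟨hr.2, fun h => hno p hp r h hr.1⟩
        have h3 := card_le_card h2
        have h4 := card_le_univ (A ∪ B)
        rw [card_compl] at h3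
        rw [card_union_of_disjoint hne] at h3 h4
        omega
    · push Not at hno
      obtain ⟨p, hp, r, hr, hpr⟩ := hno
      rw [hAdef, mem_sdiff, mem_neighborFinset, List.mem_toFinset] at hp
      rw [hBdef, mem_sdiff, mem_neighborFinset, List.mem_toFinset] at hr
      refine ⟨u :: p :: r :: v :: l, x, y, by simp at hl ⊢; omega, ?_, ?_, hx, ?_, hxy⟩
      · simp only [List.isChain_cons_cons]
        exact ⟨hp.1, hpr, hr.1.symm, hvl⟩
      · have := hpr.ne
        have h1 := hp.2
        have h2 := hr.2
        simp only [List.nodup_cons, List.mem_cons, not_or] at hn h1 h2 ⊢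
        tauto
      · simpa using hy

end SimpleGraph

/-! ### Embedding dumbbells -/

/-- Numbering the vertices backwards interchanges the two cycles. -/
theorem dumbbellGraph_isContained_swap {r₁ r₂ : ℕ} (hr₁ : 1 ≤ r₁) (hr₂ : 1 ≤ r₂) (q : ℕ) :
    (dumbbellGraph r₁ r₂ q).IsContained (dumbbellGraph r₂ r₁ q) := by
  refine ⟨⟨⟨fun i => ⟨r₁ + r₂ + q - 1 - 1 - i.val, by omega⟩, ?_⟩, ?_⟩⟩
  · rintro ⟨i, hi⟩ ⟨j, hj⟩
    simp only [dumbbellGraph, SimpleGraph.fromRel_adj, ne_eq, Fin.mk.injEq]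
    rintro ⟨hne, (h | ⟨h, h'⟩ | ⟨h, h'⟩) | (h | ⟨h, h'⟩ | ⟨h, h'⟩)⟩
    · exact ⟨by omega, .inr (.inl (by omega))⟩
    · exact ⟨by omega, .inr (.inr (.inr (by omega)))⟩
    · exact ⟨by omega, .inr (.inr (.inl (by omega)))⟩
    · exact ⟨by omega, .inl (.inl (by omega))⟩
    · exact ⟨by omega, .inl (.inr (.inr (by omega)))⟩
    · exact ⟨by omega, .inl (.inr (.inl (by omega)))⟩
  · rintro ⟨i, hi⟩ ⟨j, hj⟩
    simp only [RelHom.coeFn_mk, Fin.mk.injEq]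
    omega

theorem dumbbellGraph_isContained_of_list {V : Type*} {G : SimpleGraph V} {r₁ r₂ q : ℕ}
    {l : List V} (hlen : l.length = r₁ + r₂ + q - 1) (hchain : l.IsChain G.Adj) (hnd : l.Nodup)
    (h₁ : ∀ i j : Fin l.length, i.val = 0 → j.val = r₁ - 1 → G.Adj l[i] l[j])
    (h₂ : ∀ i j : Fin l.length, i.val = r₁ - 1 + q → j.val = r₁ + r₂ + q - 2 → G.Adj l[i] l[j]) :
    (dumbbellGraph r₁ r₂ q).IsContained G := by
  have key : ∀ i j : Fin l.length, (i.val + 1 = j.val ∨ (i.val = 0 ∧ j.val = r₁ - 1) ∨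
      (i.val = r₁ - 1 + q ∧ j.val = r₁ + r₂ + q - 2)) → G.Adj l[i] l[j] := by
    rintro i j (h | ⟨hi, hj⟩ | ⟨hi, hj⟩)
    · have := List.isChain_iff_getElem.mp hchain i.val (by omega)
      simpa [h] using this
    · exact h₁ i j hi hj
    · exact h₂ i j hi hj
  refine ⟨⟨⟨fun i => l[i.cast hlen.symm], ?_⟩, ?_⟩⟩
  · intro i j hij
    rw [dumbbellGraph, SimpleGraph.fromRel_adj] at hij
    rcases hij.2 with h | h
    · exact key (i.cast hlen.symm) (j.cast hlen.symm) h
    · exact (key (j.cast hlen.symm) (i.cast hlen.symm) h).symm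
  · intro i j hij
    have := (List.nodup_iff_injective_get.mp hnd) hij
    simpa [Fin.ext_iff] using this

/-- A dumbbell from its parts: `o` is the cycle of length `a`, the path `p` leads from it to the
vertex `w`, and `e` completes `w` to a cycle of length `b`. -/
theorem dumbbellGraph_isContained_of_append {V : Type*} {G : SimpleGraph V} {a b q : ℕ}
    {z y w x : V} {e p o : List V} (ha : 1 ≤ a) (hb : 2 ≤ b)
    (he : e.length = b - 1) (hp : p.length = q) (ho : o.length = a)
    (hchain : (e ++ (p ++ o)).IsChain G.Adj) (hnd : (e ++ (p ++ o)).Nodup)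
    (hz : e.head? = some z) (hw : (p ++ o).head? = some w) (hzw : G.Adj z w)
    (hx : o.head? = some x) (hy : o.getLast? = some y) (hxy : G.Adj x y) :
    (dumbbellGraph b a q).IsContained G := by
  refine dumbbellGraph_isContained_of_list (l := e ++ (p ++ o)) (by simp; omega) hchain hnd ?_ ?_
  · intro i j hi hj
    have e1 : (e ++ (p ++ o))[0]? = some z := by
      rw [List.getElem?_append_left (by omega), ← List.head?_eq_getElem?, hz]
    have e2 : (e ++ (p ++ o))[b - 1]? = some w := by
      rw [List.getElem?_append_right (by omega), he, Nat.sub_self, ← List.head?_eq_getElem?, hw]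
    have f1 : (e ++ (p ++ o))[i] = z := by
      rw [← hi, List.getElem?_eq_getElem i.2] at e1; exact Option.some_injective _ e1
    have f2 : (e ++ (p ++ o))[j] = w := by
      rw [← hj, List.getElem?_eq_getElem j.2] at e2; exact Option.some_injective _ e2
    rw [f1, f2]; exact hzw
  · intro i j hi hj
    have e1 : (e ++ (p ++ o))[b - 1 + q]? = some x := by
      rw [List.getElem?_append_right (by omega), List.getElem?_append_right (by omega), he, hp,
        show b - 1 + q - (b - 1) - q = 0 by omega, ← List.head?_eq_getElem?, hx]
    have e2 : (e ++ (p ++ o))[b + a + q - 2]? = some y := by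
      rw [List.getElem?_append_right (by omega), List.getElem?_append_right (by omega), he, hp,
        show b + a + q - 2 - (b - 1) - q = o.length - 1 by omega, ← List.getLast?_eq_getElem?, hy]
    have f1 : (e ++ (p ++ o))[i] = x := by
      rw [← hi, List.getElem?_eq_getElem i.2] at e1; exact Option.some_injective _ e1
    have f2 : (e ++ (p ++ o))[j] = y := by
      rw [← hj, List.getElem?_eq_getElem j.2] at e2; exact Option.some_injective _ e2
    rw [f1, f2]; exact hxy

namespace SimpleGraph
variable {V : Type*} [Fintype V] [DecidableEq V] {G : SimpleGraph V} [DecidableRel G.Adj]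

/-- A graph on at most `2 * h + 1` vertices with minimum degree at least `h` that contains a
triangle contains the dumbbell, provided `h` is large enough. The set `N(w) \ W`, where `W` are
the vertices of the odd cycle and the path, has size at least `h + 1 - |W|`, the set `Wᶜ` has size
at most `2 * h + 1 - |W|`, and `hnum` is the edge count between them that
`exists_alternating_path` asks for. -/
theorem dumbbellGraph_isContained_of_le_degree {h t r q : ℕ} (hcard : Fintype.card V ≤ 2 * h + 1)
    (hdeg : ∀ v, h ≤ G.degree v) (htri : ¬ G.CliqueFree 3) (ht : 8 * t + 12 ≤ h)
    (hr : 2 * t + 3 + q + 2 * r ≤ h)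
    (hnum : (2 * r + 1) * (2 * h + 1 - (2 * t + 3 + q)) <
      (h + 1 - (2 * t + 3 + q)) * (h - (2 * t + 3 + q + 2 * r))) :
    (dumbbellGraph (2 * r + 4) (2 * t + 3) q).IsContained G := by
  obtain ⟨o, x, y, ho, hoc, hon, hx, hy, hxy⟩ := exists_odd_cycle_list hcard hdeg htri ht
  obtain _ | ⟨x', o⟩ := o
  · simp at ho
  simp only [List.length_cons] at ho
  obtain ⟨p, hp, hc, hn, -⟩ := exists_isChain_append (G := G) (s := univ) (d := h)
    (fun v _ => by rw [inter_univ, card_neighborFinset_eq_degree]; exact hdeg v) (j := q)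
    (mem_univ x') hoc hon (by omega)
  obtain ⟨w, W, hW⟩ : ∃ w W, p ++ x' :: o = w :: W := by
    cases p <;> simp
  have hWlen : (w :: W).length = 2 * t + 3 + q := by rw [← hW]; simp; omega
  rw [hW] at hc hn
  have hcF : #(w :: W).toFinset = 2 * t + 3 + q := by
    rw [List.toFinset_card_of_nodup hn, hWlen]
  have hA : h + 1 - (2 * t + 3 + q) ≤ #(G.neighborFinset w \ (w :: W).toFinset) := by
    have h1 : G.neighborFinset w \ (w :: W).toFinset = G.neighborFinset w \ W.toFinset := by
      ext z
      simp only [mem_sdiff, mem_neighborFinset, List.mem_toFinset, List.mem_cons, not_or]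
      exact ⟨fun h => ⟨h.1, h.2.2⟩, fun h => ⟨h.1, h.1.ne', h.2⟩⟩
    have h2 := le_card_sdiff W.toFinset (G.neighborFinset w)
    rw [List.toFinset_card_of_nodup (List.nodup_cons.mp hn).2, card_neighborFinset_eq_degree] at h2
    have := hdeg w
    simp only [List.length_cons] at hWlen
    rw [h1]
    omega
  obtain ⟨e, z, y', he, hec, hen, hz, hzm, hy', hym, hall⟩ :=
    exists_alternating_path (G := G) (t := r + 1) (A := G.neighborFinset w \ (w :: W).toFinset)
      (X := ((w :: W).toFinset)ᶜ) (by
      have hsum := card_nsmul_le_sum (G.neighborFinset w \ (w :: W).toFinset)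
        (fun a => #(G.neighborFinset a ∩ ((w :: W).toFinset)ᶜ)) (h - (2 * t + 3 + q))
        (fun a _ => by
          rw [← sdiff_eq_inter_compl]
          have h1 := le_card_sdiff (w :: W).toFinset (G.neighborFinset a)
          have := hdeg a
          rw [hcF, card_neighborFinset_eq_degree] at h1
          omega)
      refine lt_of_lt_of_le ?_ hsum
      have hX := card_compl (w :: W).toFinset
      rw [hcF] at hX
      have e1 : 2 * (r + 1) - 2 = 2 * r := by omega
      have e2 : 2 * (r + 1) - 1 = 2 * r + 1 := by omega
      rw [e1, e2, smul_eq_mul]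
      have h1 : (2 * r + 1) * #((w :: W).toFinset)ᶜ ≤
          (2 * r + 1) * (2 * h + 1 - (2 * t + 3 + q)) := Nat.mul_le_mul_left _ (by omega)
      have h2 := Nat.mul_le_mul_right (h - (2 * t + 3 + q + 2 * r)) hA
      have h3 : h - (2 * t + 3 + q) = h - (2 * t + 3 + q + 2 * r) + 2 * r := by omega
      rw [h3, mul_add]
      linarith)
  rw [mem_sdiff, mem_neighborFinset] at hzm hym
  have hdisj : ∀ a ∈ e, a ∉ w :: W := by
    intro a ha
    have := hall a ha
    rw [mem_union, mem_sdiff, mem_compl, List.mem_toFinset] at this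
    tauto
  refine dumbbellGraph_isContained_of_append (e := e) (p := p) (o := x' :: o) (by omega) (by omega)
    (by omega) hp (by simpa using ho) ?_ ?_ hz (by rw [hW]; rfl) hzm.1.symm hx hy hxy
  · rw [hW, List.isChain_append]
    refine ⟨hec, hc, ?_⟩
    rw [hy']
    simpa using hym.1.symm
  · rw [hW, List.nodup_append]
    exact ⟨hen, hn, fun a ha b hb hab => hdisj a ha (hab ▸ hb)⟩

end SimpleGraph

/-! ### The balanced complete bipartite graph -/

/-- Along the numbering of the dumbbell the two colour classes alternate, which the closing edge of
the odd cycle contradicts. -/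
theorem dumbbellGraph_free_turanGraph {n r₁ r₂ q : ℕ} (hr₁ : 2 ≤ r₁) (hr₂ : 2 ≤ r₂)
    (hodd : Odd (r₁ + r₂)) : (dumbbellGraph r₁ r₂ q).Free (SimpleGraph.turanGraph n 2) := by
  rintro ⟨f⟩
  have adj : ∀ i j : Fin (r₁ + r₂ + q - 1), i ≠ j → (i.val + 1 = j.val ∨
      (i.val = 0 ∧ j.val = r₁ - 1) ∨ (i.val = r₁ - 1 + q ∧ j.val = r₁ + r₂ + q - 2)) →
      (f i).val % 2 ≠ (f j).val % 2 := fun i j hne h =>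
    f.toHom.map_adj (by rw [dumbbellGraph, SimpleGraph.fromRel_adj]; exact ⟨hne, .inl h⟩)
  obtain ⟨s, hs⟩ := hodd
  have h0 : 0 < r₁ + r₂ + q - 1 := by omega
  have par : ∀ i (hi : i < r₁ + r₂ + q - 1), ((f ⟨i, hi⟩).val + i) % 2 = (f ⟨0, h0⟩).val % 2 := by
    intro i
    induction i with
    | zero => intro hi; simp
    | succ i ih =>
      intro hi
      have h1 := ih (by omega)
      have h2 := adj ⟨i, by omega⟩ ⟨i + 1, hi⟩ (by simp) (.inl rfl)
      omega
  rcases Nat.even_or_odd r₁ with ⟨t, ht⟩ | ⟨t, ht⟩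
  -- here the second cycle is odd
  · have h1 := par (r₁ - 1 + q) (by omega)
    have h2 := par (r₁ + r₂ + q - 2) (by omega)
    have h3 := adj ⟨r₁ - 1 + q, by omega⟩ ⟨r₁ + r₂ + q - 2, by omega⟩
      (by simp only [ne_eq, Fin.mk.injEq]; omega) (.inr (.inr ⟨rfl, rfl⟩))
    omega
  -- here the first cycle is odd
  · have h2 := par (r₁ - 1) (by omega)
    have h3 := adj ⟨0, h0⟩ ⟨r₁ - 1, by omega⟩
      (by simp only [ne_eq, Fin.mk.injEq]; omega) (.inr (.inl ⟨rfl, rfl⟩))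
    omega

theorem card_edgeFinset_turanGraph_two (n : ℕ) :
    #(SimpleGraph.turanGraph n 2).edgeFinset = n ^ 2 / 4 := by
  rw [SimpleGraph.card_edgeFinset_turanGraph]
  rcases Nat.even_or_odd' n with ⟨t, rfl | rfl⟩
  · have h1 : 2 * t % 2 = 0 := by omega
    have h2 : (2 * t) ^ 2 = 4 * t ^ 2 := by ring
    simp only [h1, h2, Nat.choose]
    omega
  · have h1 : (2 * t + 1) % 2 = 1 := by omega
    have h2 : (2 * t + 1) ^ 2 = 4 * (t ^ 2 + t) + 1 := by ring
    simp only [h1, h2, Nat.choose]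
    omega

/-! ### Passing to a subgraph of large minimum degree -/

namespace SimpleGraph

universe u in
/-- Deleting vertices of degree less than `T m` from graphs on `m` vertices, one at a time. If `φ`
is a lower bound for the number of edges that survives each deletion (`hstep`) and is impossible
on `m₀` vertices (`hφ`), then the process stops at a graph on at least `m₀` vertices. -/
theorem exists_isContained_forall_le_degree {T φ : ℕ → ℕ} {m₀ N : ℕ}
    (hφ : m₀.choose 2 < φ m₀)
    (hstep : ∀ m, m₀ ≤ m → m < N → φ m + T (m + 1) ≤ φ (m + 1) + 1) {m : ℕ} (hm₀ : m₀ ≤ m)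
    (hmN : m ≤ N) {V : Type u} [Fintype V] (G : SimpleGraph V) [DecidableRel G.Adj]
    (hV : Fintype.card V = m) (hG : φ m ≤ #G.edgeFinset) :
    ∃ (W : Type u) (_ : Fintype W) (H : SimpleGraph W) (_ : DecidableRel H.Adj),
      H.IsContained G ∧ m₀ ≤ Fintype.card W ∧ Fintype.card W ≤ N ∧
      φ (Fintype.card W) ≤ #H.edgeFinset ∧ ∀ v, T (Fintype.card W) ≤ H.degree v := by
  induction m, hm₀ using Nat.le_induction generalizing V with
  | base =>
    have := G.card_edgeFinset_le_card_choose_two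
    rw [hV] at this
    omega
  | succ m hm₀ ih =>
    classical
    by_cases hdeg : ∀ v, T (m + 1) ≤ G.degree v
    · exact ⟨V, _, G, _, .rfl, by omega, by omega, by rwa [hV], by rwa [hV]⟩
    · push Not at hdeg
      obtain ⟨v, hv⟩ := hdeg
      have h1 := G.card_edgeFinset_induce_compl_singleton v
      rw [card_edgeFinset_deleteIncidenceSet] at h1
      have h2 := hstep m hm₀ (by omega)
      obtain ⟨W, i₁, H, i₂, hH, hW⟩ := ih (by omega) (G.induce ({v}ᶜ : Set V))
        (by rw [Fintype.card_compl_set, hV]; simp) (by omega)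
      exact ⟨W, i₁, H, i₂, hH.trans (Embedding.induce _).isContained, hW⟩

/-- Mantel's theorem, from Turán's theorem. -/
theorem not_cliqueFree_three_of_lt {V : Type*} [Fintype V] {G : SimpleGraph V} [DecidableRel G.Adj]
    (h : Fintype.card V ^ 2 / 4 < #G.edgeFinset) : ¬ G.CliqueFree 3 := by
  intro hG
  have : #G.edgeFinset ≤ #(turanGraph (Fintype.card V) 2).edgeFinset := by
    rw [card_edgeFinset_turanGraph]
    exact CliqueFree.card_edgeFinset_le hG
  rw [card_edgeFinset_turanGraph_two] at this
  omega

/-- A graph on `n ≥ c (c + 1) / 2` vertices with more than `n² / 4` edges contains a graph `H`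
with a triangle and with minimum degree at least `⌊|H| / 2⌋` and at least `c`. -/
theorem exists_dense_isContained {n c : ℕ} (hc : 6 ≤ c) (hn : c * (c + 1) ≤ 2 * n)
    (G : SimpleGraph (Fin n)) [DecidableRel G.Adj] (hG : n ^ 2 / 4 < #G.edgeFinset) :
    ∃ (W : Type) (_ : Fintype W) (H : SimpleGraph W) (_ : DecidableRel H.Adj),
      H.IsContained G ∧ ¬ H.CliqueFree 3 ∧ ∀ v, max (Fintype.card W / 2) c ≤ H.degree v := by
  have hcn : 2 * c ≤ n := by nlinarith
  have hsq : ∀ m : ℕ, (m + 1) ^ 2 / 4 = m ^ 2 / 4 + (m + 1) / 2 := by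
    intro m
    rcases Nat.even_or_odd' m with ⟨t, rfl | rfl⟩
    · have h1 : (2 * t + 1) ^ 2 = 4 * (t ^ 2 + t) + 1 := by ring
      have h2 : (2 * t) ^ 2 = 4 * t ^ 2 := by ring
      omega
    · have h1 : (2 * t + 1 + 1) ^ 2 = 4 * (t ^ 2 + 2 * t + 1) := by ring
      have h2 : (2 * t + 1) ^ 2 = 4 * (t ^ 2 + t) + 1 := by ring
      omega
  -- the number of edges guaranteed on `m` vertices, where below `2c` vertices each deletion
  -- loses at most `c - 1` edges
  let φ : ℕ → ℕ := fun m =>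
    if 2 * c ≤ m then m ^ 2 / 4 + 1 + (n - m) else n - c + 1 + (c - 1) * (m - c)
  have hφ0 : c.choose 2 < φ c := by
    have : φ c = n - c + 1 := by simp [φ]; omega
    rw [this, Nat.choose_two_right]
    have : c * (c - 1) + 2 * c = c * (c + 1) := by
      obtain ⟨d, rfl⟩ := Nat.exists_eq_add_of_le' hc
      rw [show d + 6 - 1 = d + 5 by omega]; ring
    omega
  have hstep : ∀ m, c ≤ m → m < n → φ m + max ((m + 1) / 2) c ≤ φ (m + 1) + 1 := by
    intro m hm hmn
    have h1 := hsq m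
    rcases lt_trichotomy (2 * c) (m + 1) with h | h | h
    · simp only [φ, if_pos (show 2 * c ≤ m by omega), if_pos (show 2 * c ≤ m + 1 by omega)]
      omega
    · simp only [φ, if_neg (show ¬ 2 * c ≤ m by omega), if_pos (show 2 * c ≤ m + 1 by omega)]
      rw [← h]
      have h2 : (2 * c) ^ 2 / 4 = c * c := by rw [show (2 * c) ^ 2 = 4 * (c * c) by ring]; omega
      obtain ⟨d, rfl⟩ := Nat.exists_eq_add_of_le' hc
      have h3 : (d + 6 - 1) * (m - (d + 6)) = d * d + 10 * d + 25 := by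
        rw [show m - (d + 6) = d + 5 by omega, show d + 6 - 1 = d + 5 by omega]; ring
      have h4 : (d + 6) * (d + 6) = d * d + 12 * d + 36 := by ring
      omega
    · simp only [φ, if_neg (show ¬ 2 * c ≤ m by omega), if_neg (show ¬ 2 * c ≤ m + 1 by omega)]
      rw [show m + 1 - c = (m - c) + 1 by omega, mul_add]
      omega
  have hφn : φ n ≤ #G.edgeFinset := by simp [φ, hcn]; omega
  obtain ⟨W, i₁, H, i₂, hHG, hW₁, hW₂, hW₃, hW₄⟩ := exists_isContained_forall_le_degree
    (T := fun m => max (m / 2) c) hφ0 hstep (by omega) le_rfl G (Fintype.card_fin n) hφn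
  refine ⟨W, i₁, H, i₂, hHG, not_cliqueFree_three_of_lt (lt_of_lt_of_le ?_ hW₃), hW₄⟩
  generalize Fintype.card W = m at hW₁ hW₂
  by_cases h : 2 * c ≤ m
  · simp only [φ, if_pos h]; omega
  · simp only [φ, if_neg h]
    obtain ⟨x, rfl⟩ := Nat.exists_eq_add_of_le hW₁
    obtain ⟨y, rfl⟩ := Nat.exists_eq_add_of_le' hc
    obtain ⟨z, rfl⟩ := Nat.exists_eq_add_of_le (show y + 6 ≤ n by omega)
    simp only [Nat.add_sub_cancel_left]
    rw [show y + 6 - 1 = y + 5 by omega, Nat.div_lt_iff_lt_mul (by norm_num)]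
    have hx : x < y + 6 := by omega
    obtain ⟨w, hw⟩ := Nat.exists_eq_add_of_lt hx
    obtain rfl : y = x + w - 5 := by omega
    nlinarith

end SimpleGraph

/-! ### The extremal number -/

/-- The numerical hypotheses of `SimpleGraph.dumbbellGraph_isContained_of_le_degree` hold for `h ≥
⌊7k / 5⌋`. The factor `7 / 5` is just below `√2`, and `√2 * k` is about the largest value of `c`
with `c (c + 1) / 2 ≤ k² + k`. -/
theorem dumbbellGraph_bounds {t r q c k h : ℕ}
    (hk : k = 3 * (2 * t + 3) + 3 * (2 * r + 4) + 2 * q - 12) (hc : c = 7 * k / 5) (hh : c ≤ h) :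
    8 * t + 12 ≤ h ∧ 2 * t + 3 + q + 2 * r ≤ h ∧
    (2 * r + 1) * (2 * h + 1 - (2 * t + 3 + q)) <
      (h + 1 - (2 * t + 3 + q)) * (h - (2 * t + 3 + q + 2 * r)) := by
  refine ⟨by omega, by omega, ?_⟩
  obtain ⟨y, rfl⟩ := Nat.exists_eq_add_of_le (show 2 * t + 3 + q + 2 * r ≤ h by omega)
  calc _ ≤ (2 * r + 1) * (3 * y) := Nat.mul_le_mul_left _ (by omega)
    _ = (3 * (2 * r + 1)) * y := by ring
    _ < _ := by
      rw [Nat.add_sub_cancel_left]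
      exact Nat.mul_lt_mul_of_pos_right (by omega) (by omega)

theorem SimpleGraph.dumbbellGraph_isContained_of_lt_card_edgeFinset {t r q k n : ℕ}
    (hk : k = 3 * (2 * t + 3) + 3 * (2 * r + 4) + 2 * q - 12) (hn : k ^ 2 + k ≤ n)
    (G : SimpleGraph (Fin n)) [DecidableRel G.Adj] (hG : n ^ 2 / 4 < #G.edgeFinset) :
    (dumbbellGraph (2 * r + 4) (2 * t + 3) q).IsContained G := by
  classical
  obtain ⟨c, hc⟩ : ∃ c, c = 7 * k / 5 := ⟨_, rfl⟩
  have hcn : c * (c + 1) ≤ 2 * n := by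
    have h1 : 5 * c ≤ 7 * k := by omega
    have h2 := Nat.mul_le_mul h1 h1
    have h3 : c * (c + 1) = c * c + c := by ring
    have h4 : 5 * c * (5 * c) = 25 * (c * c) := by ring
    have h5 : 7 * k * (7 * k) = 49 * (k ^ 2) := by ring
    omega
  obtain ⟨W, _, H, _, hHG, htri, hdeg⟩ := exists_dense_isContained (by omega) hcn G hG
  obtain ⟨h₁, h₂, h₃⟩ := dumbbellGraph_bounds hk hc (le_max_right (Fintype.card W / 2) c)
  exact (dumbbellGraph_isContained_of_le_degree (by omega) hdeg htri h₁ h₂ h₃).trans hHG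

theorem theorem5 (r₁ r₂ q k n : ℕ) (hr₁ : 3 ≤ r₁) (hr₂ : 4 ≤ r₂) (hodd : Odd (r₁ + r₂))
    (hk : k = 3 * r₁ + 3 * r₂ + 2 * q - 12) (hn : k ^ 2 + k ≤ n) :
    SimpleGraph.extremalNumber n (dumbbellGraph r₁ r₂ q) = n ^ 2 / 4 := by
  apply le_antisymm
  · have h := SimpleGraph.extremalNumber_le_iff (V := Fin n) (dumbbellGraph r₁ r₂ q) (n ^ 2 / 4)
    rw [Fintype.card_fin] at h
    rw [h]
    intro G _ hfree
    by_contra! hG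
    apply hfree
    obtain ⟨s, hs⟩ := hodd
    rcases Nat.even_or_odd' r₁ with ⟨x, rfl | rfl⟩
    · obtain ⟨r, rfl⟩ := Nat.exists_eq_add_of_le' (show 2 ≤ x by omega)
      obtain ⟨t, rfl⟩ : ∃ t, r₂ = 2 * t + 3 := ⟨(r₂ - 3) / 2, by omega⟩
      exact SimpleGraph.dumbbellGraph_isContained_of_lt_card_edgeFinset (by omega) hn G hG
    · obtain ⟨t, rfl⟩ := Nat.exists_eq_add_of_le' (show 1 ≤ x by omega)
      obtain ⟨r, rfl⟩ : ∃ r, r₂ = 2 * r + 4 := ⟨(r₂ - 4) / 2, by omega⟩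
      exact (dumbbellGraph_isContained_swap (by omega) (by omega) q).trans
        (SimpleGraph.dumbbellGraph_isContained_of_lt_card_edgeFinset (by omega) hn G hG)
  · have h := SimpleGraph.card_edgeFinset_le_extremalNumber
      (dumbbellGraph_free_turanGraph (n := n) (q := q) (by omega : 2 ≤ r₁) (by omega) hodd)
    rwa [card_edgeFinset_turanGraph_two, Fintype.card_fin] at h
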